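/- Let $(V,Y,\mathbf 1)$ be a nonzero vertex algebra over $\mathbb{C}$, $Y(v,x)=\sum_{n\in\mathbb{Z}}v_nx^{-n-1}$, with a $\mathbb{C}$-grading $V=\bigoplus_{\lambda\in\mathbb{C}}V_\lambda$ such that $\mathbf 1\in V_0$ and $v_nV_\lambda\subseteq V_{\lambda+\gamma-n-1}$ for $v\in V_\gamma$, $n\in\mathbb{Z}$; write $|v|=\gamma$ for $v\in V_\gamma$. Let $$\Omega(V)=\{v\in V:\ \text{for all } \gamma\in\mathbb{C},\ u\in V_\gamma,\ n\in\mathbb{Z},\ \text{if } u_nv\neq0 \text{ then } n=\gamma-1 \text{ or } n<\mathrm{Re}(\gamma)-1\}.$$ Assume that $V$ is a finitely $\Omega$-generated $\mathbb{C}_{\mathrm{Re}>0}$-graded vertex algebra with strong generators $u^1,\dots,u^k$, that is: (a) $V$ is spanned by the vectors $v^m_{n_m}\cdots v^1_{n_1}w$ with $m\ge 0$, $v^j\in V$, $n_j\in\mathbb{Z}$, $w\in\Omega(V)$; (b) the degree is well defined: $V=\bigoplus_{d\in\mathbb{C}}V(d)$, where $V(d)$ is the span of the vectors $v^m_{n_m}\cdots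 v^1_{n_1}w$ with $m\ge 0$, all $v^j$ homogeneous, $n_j\in\mathbb{Z}$, $w\in\Omega(V)$ and $\sum_j(|v^j|-n_j-1)=d$; (c) $V$ is spanned by the vectors $u^{j_m}_{-n_m}\cdots u^{j_1}_{-n_1}\mathbf 1$ with $m\ge0$, $1\le j_i\le k$ and all $n_i\ge1$; (d) $\dim\Omega(V)<\infty$. For $\lambda\in\mathbb{C}$ put $r(\lambda)=\lambda-\lceil\mathrm{Re}\,\lambda\rceil$, and let $V^0$ be the span of the homogeneous vectors whose weight $\lambda$ has $r(\lambda)=0$, i.e. is an integer. Define bilinear products on $V$ as the linear extensions of the following formulas for $u\in V_\lambda$, $v\in V$, with $\delta=1$ if $r(\lambda)=0$ and $\delta=0$ otherwise: $$u\circ v=\mathrm{Res}_z\frac{(1+z)^{\lceil\mathrm{Re}\,\lambda\rceil+\delta-1}}{z^{1+\delta}}Y(u,z)v,\qquad u*v=\delta\,\mathrm{Res}_z\frac{(1+z)^{\lceil \mathrm{Re}\,\lambda\rceil}}{z}Y(u,z)v .$$ Let $O(V)$ be the span of all $u\circ v$ with $u,v\in V$, and let $A(V)=V/O(V)$ be the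 Zhu algebra, with the product induced by $*$. Assume moreover that (1) every $u^j$ is homogeneous and its weight $|u^j|$ is not an integer; (2) $V^0=\bigoplus_{n=0}^{\infty}V_n$. Then $*$ makes $A(V)$ an associative algebra with unit $\mathbf 1+O(V)$, $\dim A(V)=1$, and $A(V)\cong\mathbb{C}$ as $\mathbb{C}$-algebras. -/

import Mathlib

noncomputable section

/-- A vertex algebra over `ℂ`. The vertex operator map is `Y(u,x) = ∑ u_n x^{-n-1}`; that
`Y(u,x)v` has finitely many negative powers of `x` is part of Mathlib's `VertexOperator`, and
`VertexOperator.ncoeff (Y u) n` is the mode `u_n`. -/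
structure VertexAlgebra (V : Type*) [AddCommGroup V] [Module ℂ V] where
  /-- the vertex operator map -/
  Y : V →ₗ[ℂ] VertexOperator ℂ V
  /-- the vacuum vector -/
  vac : V
  /-- `Y(𝟏,x) = id` -/
  vacuum : ∀ (n : ℤ) (v : V), VertexOperator.ncoeff (Y vac) n v = if n = -1 then v else 0
  /-- `Y(v,x)𝟏` has no negative powers of `x` -/
  creation_regular : ∀ (v : V) (n : ℤ), 0 ≤ n → VertexOperator.ncoeff (Y v) n vac = 0
  /-- the constant term of `Y(v,x)𝟏` is `v` -/
  creation : ∀ v : V, VertexOperator.ncoeff (Y v) (-1) vac = v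
  /-- The Jacobi identity, applied to `w`: the equality of the coefficients of
  `x₀^{-l-1} x₁^{-m-1} x₂^{-n-1}` on both sides. All the sums have finitely many nonzero terms. -/
  jacobi : ∀ (u v w : V) (l m n : ℤ),
    ∑ᶠ i : ℕ, Ring.choose m i •
        VertexOperator.ncoeff (Y (VertexOperator.ncoeff (Y u) (l + i) v)) (m + n - i) w =
      ∑ᶠ i : ℕ, ((-1 : ℤ) ^ i * Ring.choose l i) •
        (VertexOperator.ncoeff (Y u) (m + l - i) (VertexOperator.ncoeff (Y v) (n + i) w) -
          (-1 : ℂ) ^ l •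
            VertexOperator.ncoeff (Y v) (n + l - i) (VertexOperator.ncoeff (Y u) (m + i) w))

namespace VertexAlgebra

variable {V : Type*} [AddCommGroup V] [Module ℂ V] (𝒱 : VertexAlgebra V)

/-- The mode `u_n`. -/
def mode (u : V) (n : ℤ) : Module.End ℂ V := VertexOperator.ncoeff (𝒱.Y u) n

/-- `v^k_{n_k} ⋯ v^1_{n_1} w` for the list `[(v^k, n_k), …, (v^1, n_1)]`. -/
def applyModes (l : List (V × ℤ)) (w : V) : V :=
  l.foldr (fun p x => 𝒱.mode p.1 p.2 x) w

/-- `S` strongly generates `V`: every vector is a finite sum of vectors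
`v^k_{-n_k} ⋯ v^1_{-n_1} 𝟏` with `v^j ∈ S` and all `n_j ≥ 1`. -/
def StronglyGenerates (S : Set V) : Prop :=
  Submodule.span ℂ {x : V | ∃ l : List (V × ℤ),
    (∀ p ∈ l, p.1 ∈ S ∧ p.2 < 0) ∧ x = 𝒱.applyModes l 𝒱.vac} = ⊤

theorem mode_add_left (u u' : V) (n : ℤ) (v : V) :
    𝒱.mode (u + u') n v = 𝒱.mode u n v + 𝒱.mode u' n v := by
  simp [mode]

theorem mode_smul_left (a : ℂ) (u : V) (n : ℤ) (v : V) :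
    𝒱.mode (a • u) n v = a • 𝒱.mode u n v := by
  simp [mode]

/-- Lower truncation, in terms of modes. -/
theorem exists_mode_eq_zero (u v : V) : ∃ N : ℤ, ∀ n, N ≤ n → 𝒱.mode u n v = 0 := by
  refine ⟨-HahnSeries.order ((HahnModule.of ℂ).symm (𝒱.Y u v)), fun n hn => ?_⟩
  exact VertexOperator.ncoeff_eq_zero_of_lt_order _ _ _ (by omega)

theorem finite_support_residue (c m : ℤ) (u v : V) :
    (Function.support fun i : ℕ => Ring.choose c i • 𝒱.mode u (m + i) v).Finite := by
  obtain ⟨N, hN⟩ := 𝒱.exists_mode_eq_zero u v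
  refine (Set.finite_lt_nat (N - m).toNat).subset fun i hi => ?_
  by_contra h
  exact hi (by
    have h : ¬ i < (N - m).toNat := h
    simp only [hN (m + i) (by omega), smul_zero])

/-- `Res_z (1+z)^c z^m Y(u,z)v = ∑_{i ≥ 0} (c choose i) u_{m+i} v`, as a bilinear map. -/
def residue (c m : ℤ) : V →ₗ[ℂ] V →ₗ[ℂ] V :=
  LinearMap.mk₂ ℂ (fun u v => ∑ᶠ i : ℕ, Ring.choose c i • 𝒱.mode u (m + i) v)
    (fun u u' v => by
      rw [← finsum_add_distrib (𝒱.finite_support_residue c m u v)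
        (𝒱.finite_support_residue c m u' v)]
      simp only [mode_add_left, smul_add])
    (fun a u v => by
      rw [smul_finsum' a (𝒱.finite_support_residue c m u v)]
      simp only [mode_smul_left, smul_comm a])
    (fun u v v' => by
      rw [← finsum_add_distrib (𝒱.finite_support_residue c m u v)
        (𝒱.finite_support_residue c m u v')]
      simp only [map_add, smul_add])
    (fun a u v => by
      rw [smul_finsum' a (𝒱.finite_support_residue c m u v)]
      simp only [map_smul, smul_comm a])

end VertexAlgebra

/-- A `ℂ`-graded vertex algebra `V = ⨁_{λ ∈ ℂ} V_λ`. -/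
structure CGradedVertexAlgebra (V : Type*) [AddCommGroup V] [Module ℂ V] extends
    VertexAlgebra V where
  /-- the weight space `V_λ` -/
  wt : ℂ → Submodule ℂ V
  isInternal : DirectSum.IsInternal wt
  vac_mem : vac ∈ wt 0
  mode_mem : ∀ (γ lam : ℂ) (n : ℤ) (u v : V), u ∈ wt γ → v ∈ wt lam →
    toVertexAlgebra.mode u n v ∈ wt (lam + γ - n - 1)

namespace CGradedVertexAlgebra

variable {V : Type*} [AddCommGroup V] [Module ℂ V] (𝒱 : CGradedVertexAlgebra V)

/-- `Ω(V)`: the vectors `v` such that, for every `u ∈ V_γ` and `n ∈ ℤ` with `u_n v ≠ 0`, either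
`n = γ - 1` or `n < Re γ - 1`. -/
def Omega : Submodule ℂ V where
  carrier := {v | ∀ (γ : ℂ) (u : V) (n : ℤ), u ∈ 𝒱.wt γ → 𝒱.mode u n v ≠ 0 →
    (n : ℂ) = γ - 1 ∨ (n : ℝ) < γ.re - 1}
  zero_mem' := fun γ u n _ h => absurd (map_zero _) h
  add_mem' := fun {v w} hv hw γ u n hu h => by
    by_cases h0 : 𝒱.mode u n v = 0
    · refine hw γ u n hu fun h1 => h ?_
      rw [map_add, h0, h1, add_zero]
    · exact hv γ u n hu h0
  smul_mem' := fun a v hv γ u n hu h => hv γ u n hu fun h0 => h (by rw [map_smul, h0, smul_zero])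

/-- `V` is `Ω`-generated: every vector is a finite sum of vectors `v^k_{n_k} ⋯ v^1_{n_1} u^0` with
`v^j ∈ V`, `n_j ∈ ℤ` and `u^0 ∈ Ω(V)`. -/
def IsOmegaGenerated : Prop :=
  Submodule.span ℂ {x : V | ∃ l : List (V × ℤ), ∃ w ∈ 𝒱.Omega, x = 𝒱.applyModes l w} = ⊤

/-- `V(d)`: the span of the vectors `v^k_{n_k} ⋯ v^1_{n_1} u^0` with `u^0 ∈ Ω(V)`, every `v^j`
homogeneous of weight `|v^j|`, and `∑_j (|v^j| - n_j - 1) = d`. The entries of the list are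
`((v^j, n_j), |v^j|)`. -/
def degreeSpace (d : ℂ) : Submodule ℂ V :=
  Submodule.span ℂ {x : V | ∃ l : List ((V × ℤ) × ℂ), ∃ w ∈ 𝒱.Omega,
    (∀ p ∈ l, p.1.1 ∈ 𝒱.wt p.2) ∧ (l.map fun p => p.2 - (p.1.2 : ℂ) - 1).sum = d ∧
      x = 𝒱.applyModes (l.map Prod.fst) w}

/-- An `Ω`-generated `ℂ_{Re>0}`-graded vertex algebra: `V` is `Ω`-generated and the degree, which is
`0` on `Ω(V)` and `∑_j (|v^j| - n_j - 1)` on `v^k_{n_k} ⋯ v^1_{n_1} u^0`, extended linearly, is well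
defined, that is, `V` is the direct sum of the spaces `V(d)`. -/
structure IsOmegaGeneratedRePos : Prop where
  omega_generated : 𝒱.IsOmegaGenerated
  degree_wellDefined : DirectSum.IsInternal 𝒱.degreeSpace

/-- A finitely `Ω`-generated `ℂ_{Re>0}`-graded vertex algebra, with the finite set `S` of strong
generators. -/
structure IsFinitelyOmegaGeneratedRePos (S : Set V) : Prop extends 𝒱.IsOmegaGeneratedRePos where
  finite : S.Finite
  strongly_generates : 𝒱.StronglyGenerates S
  finiteDimensional_omega : FiniteDimensional ℂ 𝒱.Omega

/-- `V^r`: the span of the homogeneous vectors `v` with `|v| - ⌈Re |v|⌉ = r`. -/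
def fracPart (r : ℂ) : Submodule ℂ V :=
  Submodule.span ℂ {v : V | ∃ lam : ℂ, v ∈ 𝒱.wt lam ∧ r = lam - (⌈lam.re⌉ : ℂ)}

/-- `δ_{r,0}` for `r = lam - ⌈Re lam⌉`. -/
def delta (lam : ℂ) : ℤ := if lam - (⌈lam.re⌉ : ℂ) = 0 then 1 else 0

/-- The decomposition `V ≃ ⨁_λ V_λ`. -/
def weightEquiv : DirectSum ℂ (fun lam => 𝒱.wt lam) ≃ₗ[ℂ] V :=
  LinearEquiv.ofBijective (DirectSum.coeLinearMap 𝒱.wt)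
    (show Function.Bijective (DirectSum.coeLinearMap 𝒱.wt) from 𝒱.isInternal)

/-- The bilinear extension of a family of bilinear products `V_λ × V → V`, each given as the
restriction of a bilinear map `V × V → V`. -/
def extend (f : ℂ → V →ₗ[ℂ] V →ₗ[ℂ] V) : V →ₗ[ℂ] V →ₗ[ℂ] V :=
  DirectSum.toModule ℂ ℂ (V →ₗ[ℂ] V) (fun lam => (f lam).comp (𝒱.wt lam).subtype) ∘ₗ
    𝒱.weightEquiv.symm.toLinearMap

theorem extend_of_mem (f : ℂ → V →ₗ[ℂ] V →ₗ[ℂ] V) {lam : ℂ} {u : V} (hu : u ∈ 𝒱.wt lam) :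
    𝒱.extend f u = f lam u := by
  have h : 𝒱.weightEquiv.symm u =
      DirectSum.lof ℂ ℂ (fun i => 𝒱.wt i) lam ⟨u, hu⟩ := by
    rw [LinearEquiv.symm_apply_eq]
    simp [weightEquiv]
  simp [extend, h]

/-- `u ∘ v`, the linear extension of
`Res_z (1+z)^{⌈Re |u|⌉ + δ_{r,0} - 1} z^{-1-δ_{r,0}} Y(u,z)v` for `u ∈ V^r` homogeneous. -/
def circ : V →ₗ[ℂ] V →ₗ[ℂ] V :=
  𝒱.extend fun lam => 𝒱.residue (⌈lam.re⌉ + delta lam - 1) (-1 - delta lam)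

/-- `u * v`, the linear extension of `δ_{r,0} Res_z (1+z)^{|u|} z^{-1} Y(u,z)v` for `u ∈ V^r`
homogeneous; where `δ_{r,0} ≠ 0`, the weight `|u|` is the integer `⌈Re |u|⌉`. -/
def star : V →ₗ[ℂ] V →ₗ[ℂ] V :=
  𝒱.extend fun lam => delta lam • 𝒱.residue ⌈lam.re⌉ (-1)

/-- `O(V)`: the span of all `u ∘ v`. -/
def zhuO : Submodule ℂ V :=
  Submodule.span ℂ {x : V | ∃ u v : V, x = 𝒱.circ u v}

/-- `V / O(V)` is an associative unital algebra under the product induced by `*`, with unit the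
class of `𝟏`. -/
structure ZhuLaws : Prop where
  star_mem_left : ∀ u v : V, u ∈ 𝒱.zhuO → 𝒱.star u v ∈ 𝒱.zhuO
  star_mem_right : ∀ u v : V, v ∈ 𝒱.zhuO → 𝒱.star u v ∈ 𝒱.zhuO
  assoc : ∀ u v w : V, 𝒱.star (𝒱.star u v) w - 𝒱.star u (𝒱.star v w) ∈ 𝒱.zhuO
  vac_star : ∀ u : V, 𝒱.star 𝒱.vac u - u ∈ 𝒱.zhuO
  star_vac : ∀ u : V, 𝒱.star u 𝒱.vac - u ∈ 𝒱.zhuO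

/-- The Zhu algebra `A(V) = V / O(V)`. The proof `h` that `*` induces an associative algebra
structure is used only in the multiplication below. -/
def ZhuAlgebra (_h : 𝒱.ZhuLaws) : Type _ := V ⧸ 𝒱.zhuO

namespace ZhuAlgebra

variable {𝒱} (h : 𝒱.ZhuLaws)

instance : AddCommGroup (𝒱.ZhuAlgebra h) := inferInstanceAs (AddCommGroup (V ⧸ 𝒱.zhuO))

/-- The quotient vector space structure. -/
@[reducible]
def quotientModule : Module ℂ (𝒱.ZhuAlgebra h) := inferInstanceAs (Module ℂ (V ⧸ 𝒱.zhuO))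

/-- The class `[u] = u + O(V)`. -/
def mk (u : V) : 𝒱.ZhuAlgebra h := Submodule.Quotient.mk (p := 𝒱.zhuO) u

/-- The product `[u][v] = [u * v]`. -/
def mul (a b : 𝒱.ZhuAlgebra h) : 𝒱.ZhuAlgebra h :=
  Quotient.map₂ (fun u v => 𝒱.star u v) (by
    intro u u' hu v v' hv
    replace hu : u - u' ∈ 𝒱.zhuO := (Submodule.quotientRel_def _).1 hu
    replace hv : v - v' ∈ 𝒱.zhuO := (Submodule.quotientRel_def _).1 hv
    refine (Submodule.quotientRel_def _).2 ?_
    have e : 𝒱.star u v - 𝒱.star u' v' = 𝒱.star (u - u') v + 𝒱.star u' (v - v') := by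
      simp
    rw [e]
    exact add_mem (h.star_mem_left _ _ hu) (h.star_mem_right _ _ hv)) a b

instance : Ring (𝒱.ZhuAlgebra h) :=
  { (inferInstance : AddCommGroup (𝒱.ZhuAlgebra h)) with
    mul := mul h
    one := mk h 𝒱.vac
    left_distrib := by
      rintro ⟨u⟩ ⟨v⟩ ⟨w⟩
      exact congrArg (mk h) (map_add (𝒱.star u) v w)
    right_distrib := by
      rintro ⟨u⟩ ⟨v⟩ ⟨w⟩
      exact congrArg (mk h) (LinearMap.map_add₂ 𝒱.star u v w)
    zero_mul := by
      rintro ⟨u⟩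
      exact congrArg (mk h) (LinearMap.map_zero₂ 𝒱.star u)
    mul_zero := by
      rintro ⟨u⟩
      exact congrArg (mk h) (map_zero (𝒱.star u))
    mul_assoc := by
      rintro ⟨u⟩ ⟨v⟩ ⟨w⟩
      exact (Submodule.Quotient.eq _).2 (h.assoc u v w)
    one_mul := by
      rintro ⟨u⟩
      exact (Submodule.Quotient.eq _).2 (h.vac_star u)
    mul_one := by
      rintro ⟨u⟩
      exact (Submodule.Quotient.eq _).2 (h.star_vac u) }

instance : Algebra ℂ (𝒱.ZhuAlgebra h) :=
  letI := quotientModule h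
  Algebra.ofModule
    (by
      rintro a ⟨u⟩ ⟨v⟩
      exact congrArg (mk h) (LinearMap.map_smul₂ 𝒱.star a u v))
    (by
      rintro a ⟨u⟩ ⟨v⟩
      exact congrArg (mk h) (map_smul (𝒱.star u) a v))

theorem mk_star (u v : V) : mk h (𝒱.star u v) = mk h u * mk h v := rfl

theorem mk_vac : mk h 𝒱.vac = 1 := rfl

theorem mk_smul (a : ℂ) (u : V) : mk h (a • u) = a • mk h u := rfl

end ZhuAlgebra

end CGradedVertexAlgebra

end

/-!
Let `w ∈ Ω(V)` be nonzero. The zero modes `o(u) = u_{|u|-1}`, with `o(u) = 0` in nonintegral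
weight, satisfy `o(u ∘ v) w = 0` and `o(u * v) w = o(u) o(v) w`: the Jacobi identity expands both
left sides into terms `u_p v_q w` and `v_q u_p w`, and in all of these except `o(u) o(v) w` the
inner mode kills `w`.

On the other hand `V = O(V) + ℂ𝟏`. A homogeneous `u` of nonintegral weight equals `u ∘ 𝟏`, so only
integral weights matter. There, with `u` replaced by `u_n 𝟏`, the relation `u ∘ v ∈ O(V)` rewrites
`u_n v`, for `n < 0`, as a combination of vectors of strictly smaller integral weight. The weights
being bounded below, this descent ends at multiples of `𝟏`.

Hence `o(u) w = χ(u) w` for a linear functional `χ` with kernel `O(V)`, and `χ` carries `*` to the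
product of `ℂ`. All the algebra axioms and the isomorphism `A(V) ≅ ℂ` are read off from `χ`.
-/

theorem span_inter_eq_of_iSupIndep {ι R M : Type*} [Ring R] [AddCommGroup M] [Module R M]
    {ℳ : ι → Submodule R M} (hℳ : iSupIndep ℳ) {X : Set M} (hX : ∀ x ∈ X, ∃ i, x ∈ ℳ i)
    (hspan : Submodule.span R X = ⊤) (i : ι) :
    Submodule.span R (X ∩ ℳ i) = ℳ i := by
  have hle : (fun i => Submodule.span R (X ∩ ℳ i)) ≤ ℳ :=
    fun i => Submodule.span_le.2 Set.inter_subset_right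
  have htop : ⨆ i, Submodule.span R (X ∩ ℳ i) = ⊤ := by
    rw [eq_top_iff, ← hspan, Submodule.span_le]
    intro x hx
    obtain ⟨i, hi⟩ := hX x hx
    exact Submodule.mem_iSup_of_mem i (Submodule.subset_span ⟨hx, hi⟩)
  exact congrFun ((hℳ.le_iff_eq_of_iSup_eq_top htop).1 hle) i

theorem exists_dual_smul_eq {R U W : Type*} [Ring R] [IsDomain R] [AddCommGroup U] [Module R U]
    [AddCommGroup W] [Module R W] [Module.IsTorsionFree R W] {f : U →ₗ[R] W} {w : W} (hw : w ≠ 0)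
    (hf : ∀ u, f u ∈ Submodule.span R {w}) : ∃ χ : U →ₗ[R] R, ∀ u, χ u • w = f u := by
  let e := LinearEquiv.toSpanNonzeroSingleton R W w hw
  refine ⟨e.symm.toLinearMap ∘ₗ f.codRestrict _ hf, fun u => ?_⟩
  exact congrArg Subtype.val (e.apply_symm_apply (f.codRestrict _ hf u))

namespace VertexAlgebra

variable {V : Type*} [AddCommGroup V] [Module ℂ V] (𝒱 : VertexAlgebra V)

/-- The mode `u_n` as a linear function of `u`. -/
noncomputable def modeLinear (n : ℤ) : V →ₗ[ℂ] Module.End ℂ V :=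
  LinearMap.proj n ∘ₗ VertexOperator.ncoeff ∘ₗ 𝒱.Y

theorem modeLinear_apply (n : ℤ) (u : V) : 𝒱.modeLinear n u = 𝒱.mode u n := rfl

theorem mode_vac (n : ℤ) (v : V) : 𝒱.mode 𝒱.vac n v = if n = -1 then v else 0 :=
  𝒱.vacuum n v

theorem applyModes_zero (l : List (V × ℤ)) : 𝒱.applyModes l 0 = 0 := by
  induction l with
  | nil => rfl
  | cons p l ih => exact (congrArg (𝒱.mode p.1 p.2) ih).trans (map_zero _)

theorem residue_apply (c m : ℤ) (u v : V) :
    𝒱.residue c m u v = ∑ᶠ i : ℕ, Ring.choose c i • 𝒱.mode u (m + i) v := rfl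

theorem map_residue {W : Type*} [AddCommGroup W] [Module ℂ W] (f : V →ₗ[ℂ] W) (c m : ℤ)
    (u v : V) :
    f (𝒱.residue c m u v) = ∑ᶠ i : ℕ, Ring.choose c i • f (𝒱.mode u (m + i) v) := by
  simp only [residue_apply, map_finsum f (𝒱.finite_support_residue c m u v), map_zsmul]

theorem jacobi_mode (u v w : V) (l m n : ℤ) :
    ∑ᶠ i : ℕ, Ring.choose m i • 𝒱.mode (𝒱.mode u (l + i) v) (m + n - i) w =
      ∑ᶠ i : ℕ, ((-1 : ℤ) ^ i * Ring.choose l i) •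
        (𝒱.mode u (m + l - i) (𝒱.mode v (n + i) w) -
          (-1 : ℂ) ^ l • 𝒱.mode v (n + l - i) (𝒱.mode u (m + i) w)) :=
  𝒱.jacobi u v w l m n

theorem residue_neg_one_vac (c : ℤ) (u : V) : 𝒱.residue c (-1) u 𝒱.vac = u := by
  rw [residue_apply, finsum_eq_single _ 0]
  · rw [Ring.choose_zero_right, one_smul, Nat.cast_zero, add_zero]
    exact 𝒱.creation u
  · intro i hi
    rw [show 𝒱.mode u (-1 + i) 𝒱.vac = 0 from 𝒱.creation_regular u _ (by omega), smul_zero]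

theorem mode_mode_vac_neg_one (u v : V) {n : ℤ} (hn : n < 0) :
    𝒱.mode (𝒱.mode u n 𝒱.vac) (-1) v = 𝒱.mode u n v := by
  have h := 𝒱.jacobi_mode u 𝒱.vac v n 0 (-1)
  rw [finsum_eq_single _ 0, finsum_eq_single _ 0] at h
  · simpa [mode_vac, hn.ne] using h
  · intro i hi
    rw [mode_vac, mode_vac, if_neg (by omega), if_neg (by omega)]
    simp
  · intro i hi
    rw [Ring.choose_zero_pos ℤ (Nat.pos_of_ne_zero hi), zero_smul]

variable {𝒱} in
theorem mode_mem_of_residue_mem {T : Submodule ℂ V} {c m : ℤ} {u v : V}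
    (hres : 𝒱.residue c m u v ∈ T) (hT : ∀ n > m, 𝒱.mode u n v ∈ T) : 𝒱.mode u m v ∈ T := by
  have hfin := 𝒱.finite_support_residue c m u v
  rw [residue_apply, ← add_finsum_cond_ne 0 hfin] at hres
  have htail : ∑ᶠ (i : ℕ) (_ : i ≠ 0), Ring.choose c i • 𝒱.mode u (m + i) v ∈ T :=
    finsum_mem_induction (· ∈ T) T.zero_mem (fun _ _ => T.add_mem) fun i hi =>
      T.smul_of_tower_mem _ (hT _ (by have := Nat.pos_of_ne_zero hi; omega))
  simpa using (T.add_mem_iff_left htail).1 hres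

end VertexAlgebra

namespace CGradedVertexAlgebra

open VertexAlgebra

variable {V : Type*} [AddCommGroup V] [Module ℂ V] (𝒱 : CGradedVertexAlgebra V)

theorem iSup_wt : ⨆ lam, 𝒱.wt lam = ⊤ := 𝒱.isInternal.submodule_iSup_eq_top

theorem iSupIndep_wt : iSupIndep 𝒱.wt := 𝒱.isInternal.submodule_iSupIndep

theorem homogeneous_induction {p : V → Prop} (v : V)
    (hom : ∀ lam, ∀ v ∈ 𝒱.wt lam, p v) (add : ∀ x y, p x → p y → p (x + y)) : p v :=
  Submodule.iSup_induction 𝒱.wt (motive := p) (x := v) (𝒱.iSup_wt ▸ Submodule.mem_top)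
    hom (hom 0 0 (zero_mem _)) add

variable {𝒱} in
theorem wt_eq_of_mem_of_mem {v : V} (hv : v ≠ 0) {lam mu : ℂ} (hlam : v ∈ 𝒱.wt lam)
    (hmu : v ∈ 𝒱.wt mu) : lam = mu := by
  by_contra hne
  exact hv (Submodule.disjoint_def.1 (𝒱.iSupIndep_wt.pairwiseDisjoint hne) v hlam hmu)

theorem exists_applyModes_mem_wt {l : List (V × ℤ)} (hl : ∀ p ∈ l, ∃ lam, p.1 ∈ 𝒱.wt lam)
    {w : V} {nu : ℂ} (hw : w ∈ 𝒱.wt nu) : ∃ mu, 𝒱.applyModes l w ∈ 𝒱.wt mu := by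
  induction l with
  | nil => exact ⟨nu, hw⟩
  | cons p l ih =>
    obtain ⟨mu, hmu⟩ := ih fun q hq => hl q (List.mem_cons_of_mem _ hq)
    obtain ⟨lam, hlam⟩ := hl p List.mem_cons_self
    exact ⟨_, 𝒱.mode_mem lam mu p.2 _ _ hlam hmu⟩

theorem delta_intCast (n : ℤ) : delta (n : ℂ) = 1 := by simp [delta]

theorem delta_of_nonint {lam : ℂ} (h : ∀ n : ℤ, lam ≠ n) : delta lam = 0 := by
  simp [delta, sub_eq_zero, h]

theorem circ_of_nonint {lam : ℂ} (h : ∀ n : ℤ, lam ≠ n) {u : V} (hu : u ∈ 𝒱.wt lam) (v : V) :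
    𝒱.circ u v = 𝒱.residue (⌈lam.re⌉ - 1) (-1) u v := by
  simp [circ, 𝒱.extend_of_mem _ hu, delta_of_nonint h]

theorem circ_of_int {n : ℤ} {u : V} (hu : u ∈ 𝒱.wt n) (v : V) :
    𝒱.circ u v = 𝒱.residue n (-2) u v := by
  simp [circ, 𝒱.extend_of_mem _ hu, delta_intCast]

theorem star_of_nonint {lam : ℂ} (h : ∀ n : ℤ, lam ≠ n) {u : V} (hu : u ∈ 𝒱.wt lam) (v : V) :
    𝒱.star u v = 0 := by
  simp [star, 𝒱.extend_of_mem _ hu, delta_of_nonint h]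

theorem star_of_int {n : ℤ} {u : V} (hu : u ∈ 𝒱.wt n) (v : V) :
    𝒱.star u v = 𝒱.residue n (-1) u v := by
  simp [star, 𝒱.extend_of_mem _ hu, delta_intCast]

theorem circ_mem_zhuO (u v : V) : 𝒱.circ u v ∈ 𝒱.zhuO := Submodule.subset_span ⟨u, v, rfl⟩

theorem wt_le_zhuO_of_nonint {lam : ℂ} (h : ∀ n : ℤ, lam ≠ n) : 𝒱.wt lam ≤ 𝒱.zhuO := by
  intro u hu
  have hcirc : 𝒱.circ u 𝒱.vac = u := by rw [𝒱.circ_of_nonint h hu, residue_neg_one_vac]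
  exact hcirc ▸ 𝒱.circ_mem_zhuO u 𝒱.vac

section ZeroMode

/-- The zero mode `o(u)`, the linear extension of `u ↦ u_{|u|-1}` for `u` homogeneous of integral
weight and `u ↦ 0` for `u` homogeneous of nonintegral weight. It makes `Ω(V)` a module for the Zhu
algebra. -/
noncomputable def zeroMode : V →ₗ[ℂ] V →ₗ[ℂ] V :=
  𝒱.extend fun lam => delta lam • 𝒱.modeLinear (⌈lam.re⌉ - 1)

theorem zeroMode_of_nonint {lam : ℂ} (h : ∀ n : ℤ, lam ≠ n) {u : V} (hu : u ∈ 𝒱.wt lam) :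
    𝒱.zeroMode u = 0 := by
  simp [zeroMode, 𝒱.extend_of_mem _ hu, delta_of_nonint h]

theorem zeroMode_of_int {n : ℤ} {lam : ℂ} (h : lam = n) {u : V} (hu : u ∈ 𝒱.wt lam) :
    𝒱.zeroMode u = 𝒱.mode u (n - 1) := by
  subst h
  simp [zeroMode, 𝒱.extend_of_mem _ hu, delta_intCast, modeLinear_apply]

theorem zeroMode_vac (w : V) : 𝒱.zeroMode 𝒱.vac w = w := by
  simp [𝒱.zeroMode_of_int (n := 0) (by simp) 𝒱.vac_mem, mode_vac]

theorem zeroMode_residue_of_nonint {lam mu : ℂ} {u v : V} (hu : u ∈ 𝒱.wt lam)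
    (hv : v ∈ 𝒱.wt mu) (h : ∀ s : ℤ, mu + lam ≠ s) (c m : ℤ) :
    𝒱.zeroMode (𝒱.residue c m u v) = 0 := by
  rw [map_residue]
  refine finsum_eq_zero_of_forall_eq_zero fun i => ?_
  rw [𝒱.zeroMode_of_nonint _ (𝒱.mode_mem _ _ _ _ _ hu hv), smul_zero]
  intro n hn
  refine h (n + (m + i) + 1) ?_
  push_cast at hn ⊢
  linear_combination hn

theorem zeroMode_residue_apply {lam mu : ℂ} {u v : V} (hu : u ∈ 𝒱.wt lam) (hv : v ∈ 𝒱.wt mu)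
    {s : ℤ} (hs : mu + lam = s) (c m : ℤ) (w : V) :
    𝒱.zeroMode (𝒱.residue c m u v) w =
      ∑ᶠ i : ℕ, ((-1 : ℤ) ^ i * Ring.choose m i) •
        (𝒱.mode u (c + m - i) (𝒱.mode v (s - c - m - 2 + i) w) -
          (-1 : ℂ) ^ m • 𝒱.mode v (s - c - m - 2 + m - i) (𝒱.mode u (c + i) w)) := by
  rw [← LinearMap.flip_apply, map_residue, ← jacobi_mode]
  refine finsum_congr fun i => ?_
  have hwt : mu + lam - (m + i : ℤ) - 1 = (s - (m + i) - 1 : ℤ) := by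
    rw [hs]
    push_cast
    ring
  rw [LinearMap.flip_apply, 𝒱.zeroMode_of_int hwt (𝒱.mode_mem _ _ _ _ _ hu hv)]
  congr 3
  ring

theorem zeroMode_residue_apply_eq_zero {lam mu : ℂ} {u v : V} (hu : u ∈ 𝒱.wt lam)
    (hv : v ∈ 𝒱.wt mu) {s : ℤ} (hs : mu + lam = s) {c m : ℤ} {w : V}
    (huw : ∀ n ≥ c, 𝒱.mode u n w = 0) (hvw : ∀ n ≥ s - c - m - 2, 𝒱.mode v n w = 0) :
    𝒱.zeroMode (𝒱.residue c m u v) w = 0 := by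
  rw [𝒱.zeroMode_residue_apply hu hv hs]
  refine finsum_eq_zero_of_forall_eq_zero fun i => ?_
  rw [huw _ (by omega), hvw _ (by omega)]
  simp only [map_zero, smul_zero, sub_zero]

variable {𝒱} {w : V} (hw : w ∈ 𝒱.Omega)

include hw

theorem mode_eq_zero_of_mem_Omega_of_int {k : ℤ} {u : V} (hu : u ∈ 𝒱.wt k) {n : ℤ}
    (hn : k ≤ n) : 𝒱.mode u n w = 0 := by
  by_contra h
  rcases hw k u n hu h with h | h
  · have : n = k - 1 := by exact_mod_cast h
    omega
  · have : (k : ℝ) ≤ n := by exact_mod_cast hn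
    rw [Complex.intCast_re] at h
    linarith

theorem mode_eq_zero_of_mem_Omega_of_nonint {lam : ℂ} (hlam : ∀ n : ℤ, lam ≠ n) {u : V}
    (hu : u ∈ 𝒱.wt lam) {n : ℤ} (hn : lam.re - 1 ≤ n) : 𝒱.mode u n w = 0 := by
  by_contra h
  rcases hw lam u n hu h with h | h
  · refine hlam (n + 1) ?_
    push_cast
    linear_combination -h
  · linarith

theorem zeroMode_circ_apply_of_int {k : ℤ} {mu : ℂ} {u v : V} (hu : u ∈ 𝒱.wt k)
    (hv : v ∈ 𝒱.wt mu) {s : ℤ} (hs : mu + k = s) : 𝒱.zeroMode (𝒱.circ u v) w = 0 := by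
  obtain rfl : mu = (s - k : ℤ) := by
    push_cast
    linear_combination hs
  rw [𝒱.circ_of_int hu]
  exact 𝒱.zeroMode_residue_apply_eq_zero hu hv hs
    (fun n hn => mode_eq_zero_of_mem_Omega_of_int hw hu hn)
    (fun n hn => mode_eq_zero_of_mem_Omega_of_int hw hv (by omega))

theorem zeroMode_circ_apply_of_nonint {lam mu : ℂ} (hlam : ∀ n : ℤ, lam ≠ n) {u v : V}
    (hu : u ∈ 𝒱.wt lam) (hv : v ∈ 𝒱.wt mu) {s : ℤ} (hs : mu + lam = s) :
    𝒱.zeroMode (𝒱.circ u v) w = 0 := by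
  have hmu : ∀ n : ℤ, mu ≠ n := by
    intro n hn
    refine hlam (s - n) ?_
    push_cast
    linear_combination hs - hn
  have hre : mu.re + lam.re = s := by simpa using congrArg Complex.re hs
  rw [𝒱.circ_of_nonint hlam hu]
  refine 𝒱.zeroMode_residue_apply_eq_zero hu hv hs (fun n hn => ?_) (fun n hn => ?_)
  · refine mode_eq_zero_of_mem_Omega_of_nonint hw hlam hu ?_
    have hn' : (⌈lam.re⌉ : ℝ) - 1 ≤ n := by exact_mod_cast hn
    linarith [Int.le_ceil lam.re]
  · refine mode_eq_zero_of_mem_Omega_of_nonint hw hmu hv ?_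
    have hn' : (s : ℝ) - ⌈lam.re⌉ ≤ n := by exact_mod_cast (by omega : s - ⌈lam.re⌉ ≤ n)
    linarith [Int.ceil_lt_add_one lam.re]

theorem zeroMode_circ_apply (u v : V) : 𝒱.zeroMode (𝒱.circ u v) w = 0 := by
  induction u using 𝒱.homogeneous_induction with
  | add x y hx hy => simp [hx, hy]
  | hom lam u hu =>
  induction v using 𝒱.homogeneous_induction with
  | add x y hx hy => simp [hx, hy]
  | hom mu v hv =>
  by_cases hs : ∃ s : ℤ, mu + lam = s
  · obtain ⟨s, hs⟩ := hs
    by_cases hlam : ∃ k : ℤ, lam = k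
    · obtain ⟨k, rfl⟩ := hlam
      exact zeroMode_circ_apply_of_int hw hu hv hs
    · exact zeroMode_circ_apply_of_nonint hw (not_exists.1 hlam) hu hv hs
  · rw [circ, 𝒱.extend_of_mem _ hu, 𝒱.zeroMode_residue_of_nonint hu hv (not_exists.1 hs),
      LinearMap.zero_apply]

theorem zeroMode_apply_of_mem_zhuO {a : V} (ha : a ∈ 𝒱.zhuO) : 𝒱.zeroMode a w = 0 := by
  have hle : 𝒱.zhuO ≤ LinearMap.ker (𝒱.zeroMode.flip w) := by
    refine Submodule.span_le.2 ?_
    rintro _ ⟨u, v, rfl⟩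
    exact zeroMode_circ_apply hw u v
  exact hle ha

theorem zeroMode_star_apply_of_int {k l : ℤ} {u v : V} (hu : u ∈ 𝒱.wt k) (hv : v ∈ 𝒱.wt l) :
    𝒱.zeroMode (𝒱.star u v) w = 𝒱.zeroMode u (𝒱.zeroMode v w) := by
  have hs : (l : ℂ) + k = (l + k : ℤ) := by push_cast; rfl
  have hvanish (i : ℕ) : 𝒱.mode u (k + i) w = 0 :=
    mode_eq_zero_of_mem_Omega_of_int hw hu (by omega)
  rw [𝒱.star_of_int hu, 𝒱.zeroMode_residue_apply hu hv hs, finsum_eq_single _ 0]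
  · have hl : l + k - k - -1 - 2 + ((0 : ℕ) : ℤ) = l - 1 := by push_cast; ring
    rw [hvanish, hl, 𝒱.zeroMode_of_int rfl hu, 𝒱.zeroMode_of_int rfl hv]
    simp [sub_eq_add_neg]
  · intro i hi
    rw [hvanish, mode_eq_zero_of_mem_Omega_of_int hw hv (by omega)]
    simp only [map_zero, smul_zero, sub_zero]

theorem zeroMode_star_apply (u v : V) :
    𝒱.zeroMode (𝒱.star u v) w = 𝒱.zeroMode u (𝒱.zeroMode v w) := by
  induction u using 𝒱.homogeneous_induction with
  | add x y hx hy => simp [hx, hy]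
  | hom lam u hu =>
  induction v using 𝒱.homogeneous_induction with
  | add x y hx hy => simp [hx, hy]
  | hom mu v hv =>
  by_cases hlam : ∃ k : ℤ, lam = k
  · obtain ⟨k, rfl⟩ := hlam
    by_cases hmu : ∃ l : ℤ, mu = l
    · obtain ⟨l, rfl⟩ := hmu
      exact zeroMode_star_apply_of_int hw hu hv
    · have hs : ∀ s : ℤ, mu + k ≠ s := by
        intro s hs
        refine hmu ⟨s - k, ?_⟩
        push_cast
        linear_combination hs
      rw [𝒱.star_of_int hu, 𝒱.zeroMode_residue_of_nonint hu hv hs,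
        𝒱.zeroMode_of_nonint (not_exists.1 hmu) hv]
      simp only [LinearMap.zero_apply, map_zero]
  · rw [𝒱.star_of_nonint (not_exists.1 hlam) hu, 𝒱.zeroMode_of_nonint (not_exists.1 hlam) hu]
    simp only [map_zero, LinearMap.zero_apply]

end ZeroMode

section Generation

variable {𝒱}

theorem mode_neg_one_mem_of_forall_lt {T : Submodule ℂ V} (hT : 𝒱.zhuO ≤ T) {N : ℤ}
    (hN : ∀ m < N, 𝒱.wt m ≤ T) {lam mu : ℂ} (hlam : ∀ n : ℤ, lam ≠ n) {u v : V}
    (hu : u ∈ 𝒱.wt lam) (hv : v ∈ 𝒱.wt mu) (hwt : mu + lam = N) : 𝒱.mode u (-1) v ∈ T := by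
  have hres : 𝒱.residue (⌈lam.re⌉ - 1) (-1) u v ∈ T :=
    𝒱.circ_of_nonint hlam hu v ▸ hT (𝒱.circ_mem_zhuO u v)
  refine mode_mem_of_residue_mem hres fun n hn => hN (N - n - 1) (by omega) ?_
  convert 𝒱.mode_mem lam mu n u v hu hv using 2
  push_cast
  rw [hwt]

theorem mode_mem_of_forall_lt {T : Submodule ℂ V} (hT : 𝒱.zhuO ≤ T) {N : ℤ}
    (hN : ∀ m < N, 𝒱.wt m ≤ T) {lam mu : ℂ} (hlam : ∀ n : ℤ, lam ≠ n) {u v : V}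
    (hu : u ∈ 𝒱.wt lam) (hv : v ∈ 𝒱.wt mu) {n : ℤ} (hn : n < 0) (hwt : mu + lam - n - 1 = N) :
    𝒱.mode u n v ∈ T := by
  rw [← mode_mode_vac_neg_one _ _ _ hn]
  refine mode_neg_one_mem_of_forall_lt hT hN ?_ (𝒱.mode_mem lam 0 n u 𝒱.vac hu 𝒱.vac_mem) hv ?_
  · intro k hk
    refine hlam (k + n + 1) ?_
    push_cast
    linear_combination hk
  · linear_combination hwt

variable {S : Set V} (hS : 𝒱.StronglyGenerates S)
  (hnonint : ∀ u ∈ S, ∃ lam, u ∈ 𝒱.wt lam ∧ ∀ n : ℤ, lam ≠ n)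

include hS hnonint

theorem wt_le_of_forall_lt {T : Submodule ℂ V} (hT : 𝒱.zhuO ≤ T) (hvac : 𝒱.vac ∈ T) {N : ℤ}
    (hN : ∀ m < N, 𝒱.wt m ≤ T) : 𝒱.wt N ≤ T := by
  have hom {l : List (V × ℤ)} (hl : ∀ p ∈ l, p.1 ∈ S ∧ p.2 < 0) :
      ∃ mu, 𝒱.applyModes l 𝒱.vac ∈ 𝒱.wt mu :=
    𝒱.exists_applyModes_mem_wt (fun p hp => (hnonint _ (hl p hp).1).imp fun _ => And.left)
      𝒱.vac_mem
  rw [← span_inter_eq_of_iSupIndep 𝒱.iSupIndep_wt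
    (by rintro _ ⟨l, hl, rfl⟩; exact hom hl) hS N, Submodule.span_le]
  rintro _ ⟨⟨l, hl, rfl⟩, hmem⟩
  cases l with
  | nil => exact hvac
  | cons p l =>
    by_cases hzero : 𝒱.applyModes (p :: l) 𝒱.vac = 0
    · exact hzero ▸ T.zero_mem
    obtain ⟨hp, hneg⟩ := hl p List.mem_cons_self
    obtain ⟨lam, hlam, hlam_nonint⟩ := hnonint p.1 hp
    obtain ⟨mu, hmu⟩ := hom fun q hq => hl q (List.mem_cons_of_mem _ hq)
    have hwt := wt_eq_of_mem_of_mem hzero (𝒱.mode_mem lam mu p.2 _ _ hlam hmu) hmem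
    exact mode_mem_of_forall_lt hT hN hlam_nonint hlam hmu hneg hwt

theorem zhuO_sup_span_vac {N₀ : ℤ} (hbdd : ∀ m < N₀, 𝒱.wt m = ⊥) :
    𝒱.zhuO ⊔ Submodule.span ℂ {𝒱.vac} = ⊤ := by
  have hvac : 𝒱.vac ∈ 𝒱.zhuO ⊔ Submodule.span ℂ {𝒱.vac} :=
    Submodule.mem_sup_right (Submodule.mem_span_singleton_self _)
  have hint (N : ℤ) : 𝒱.wt N ≤ 𝒱.zhuO ⊔ Submodule.span ℂ {𝒱.vac} := by
    induction N using Int.strongRec (m := N₀) with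
    | lt N hN => exact (hbdd N hN).trans_le bot_le
    | ge N _ ih => exact wt_le_of_forall_lt hS hnonint le_sup_left hvac ih
  rw [eq_top_iff, ← 𝒱.iSup_wt]
  refine iSup_le fun lam => ?_
  by_cases hlam : ∃ n : ℤ, lam = n
  · obtain ⟨n, rfl⟩ := hlam
    exact hint n
  · exact (𝒱.wt_le_zhuO_of_nonint (not_exists.1 hlam)).trans le_sup_left

end Generation

/-- A linear functional on `V` which induces an isomorphism from the Zhu algebra `A(V)` onto `ℂ`.
It is expressed on `V` itself because the ring structure of `A(V)` requires `ZhuLaws`, which such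
a functional implies. -/
structure IsFaithfulZhuCharacter (χ : V →ₗ[ℂ] ℂ) : Prop where
  ker_eq : LinearMap.ker χ = 𝒱.zhuO
  map_vac : χ 𝒱.vac = 1
  map_star : ∀ u v, χ (𝒱.star u v) = χ u * χ v

namespace IsFaithfulZhuCharacter

variable {𝒱} {χ : V →ₗ[ℂ] ℂ} (hχ : 𝒱.IsFaithfulZhuCharacter χ)

include hχ

theorem mem_zhuO_iff {u : V} : u ∈ 𝒱.zhuO ↔ χ u = 0 := by
  rw [← hχ.ker_eq, LinearMap.mem_ker]

theorem zhuLaws : 𝒱.ZhuLaws where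
  star_mem_left u v hu := by
    rw [hχ.mem_zhuO_iff] at hu ⊢
    rw [hχ.map_star, hu, zero_mul]
  star_mem_right u v hv := by
    rw [hχ.mem_zhuO_iff] at hv ⊢
    rw [hχ.map_star, hv, mul_zero]
  assoc u v w := by
    simp only [hχ.mem_zhuO_iff, map_sub, hχ.map_star, mul_assoc, sub_self]
  vac_star u := by
    simp only [hχ.mem_zhuO_iff, map_sub, hχ.map_star, hχ.map_vac, one_mul, sub_self]
  star_vac u := by
    simp only [hχ.mem_zhuO_iff, map_sub, hχ.map_star, hχ.map_vac, mul_one, sub_self]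

theorem surjective : Function.Surjective χ :=
  fun a => ⟨a • 𝒱.vac, by rw [map_smul, hχ.map_vac, smul_eq_mul, mul_one]⟩

/-- The isomorphism `A(V) ≅ ℂ` induced by a faithful character. -/
noncomputable def algEquiv (h : 𝒱.ZhuLaws) : 𝒱.ZhuAlgebra h ≃ₐ[ℂ] ℂ :=
  AlgEquiv.ofLinearEquiv
    (Submodule.quotEquivOfEq _ _ hχ.ker_eq.symm ≪≫ₗ χ.quotKerEquivOfSurjective hχ.surjective)
    hχ.map_vac
    (by rintro ⟨u⟩ ⟨v⟩; exact hχ.map_star u v)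

end IsFaithfulZhuCharacter

variable {𝒱}

theorem exists_isFaithfulZhuCharacter (htop : 𝒱.zhuO ⊔ Submodule.span ℂ {𝒱.vac} = ⊤)
    (hΩ : 𝒱.Omega ≠ ⊥) : ∃ χ : V →ₗ[ℂ] ℂ, 𝒱.IsFaithfulZhuCharacter χ := by
  obtain ⟨w, hw, hw0⟩ := Submodule.exists_mem_ne_zero_of_ne_bot hΩ
  have hscalar (u : V) : ∃ a : ℂ, u - a • 𝒱.vac ∈ 𝒱.zhuO ∧ 𝒱.zeroMode u w = a • w := by
    obtain ⟨o, ho, y, hy, rfl⟩ := Submodule.mem_sup.1 (htop ▸ Submodule.mem_top : u ∈ _)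
    obtain ⟨a, rfl⟩ := Submodule.mem_span_singleton.1 hy
    exact ⟨a, by simpa using ho, by simp [zeroMode_apply_of_mem_zhuO hw ho, zeroMode_vac]⟩
  obtain ⟨χ, hχ⟩ : ∃ χ : V →ₗ[ℂ] ℂ, ∀ u, χ u • w = 𝒱.zeroMode u w :=
    exists_dual_smul_eq (f := 𝒱.zeroMode.flip w) hw0 fun u =>
      Submodule.mem_span_singleton.2 ((hscalar u).imp fun _ h => h.2.symm)
  have hχ_eq {u : V} {a : ℂ} (h : 𝒱.zeroMode u w = a • w) : χ u = a :=
    smul_left_injective ℂ hw0 ((hχ u).trans h)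
  refine ⟨χ, ?_, hχ_eq ?_, fun u v => hχ_eq ?_⟩
  · ext u
    rw [LinearMap.mem_ker]
    refine ⟨fun hu => ?_, fun hu => hχ_eq ?_⟩
    · obtain ⟨a, hmem, ha⟩ := hscalar u
      simpa [← hχ_eq ha, hu] using hmem
    · rw [zeroMode_apply_of_mem_zhuO hw hu, zero_smul]
  · rw [zeroMode_vac, one_smul]
  · rw [zeroMode_star_apply hw, ← hχ v, map_smul, ← hχ u, smul_smul, mul_comm]

theorem IsOmegaGenerated.omega_ne_bot [Nontrivial V] (h : 𝒱.IsOmegaGenerated) :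
    𝒱.Omega ≠ ⊥ := by
  intro hΩ
  have hle : (⊤ : Submodule ℂ V) ≤ ⊥ := by
    rw [← h, Submodule.span_le]
    rintro _ ⟨l, w, hw, rfl⟩
    rw [hΩ, Submodule.mem_bot] at hw
    rw [hw, applyModes_zero]
    exact zero_mem _
  exact bot_ne_top (bot_unique hle).symm

theorem wt_eq_bot_of_neg (h : 𝒱.fracPart 0 ≤ ⨆ n : ℕ, 𝒱.wt n) {m : ℤ} (hm : m < 0) :
    𝒱.wt m = ⊥ := by
  have hle_frac : 𝒱.wt m ≤ 𝒱.fracPart 0 :=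
    fun x hx => Submodule.subset_span ⟨m, hx, by simp⟩
  have hle_ne : ⨆ n : ℕ, 𝒱.wt n ≤ ⨆ (mu : ℂ) (_ : mu ≠ m), 𝒱.wt mu :=
    iSup_le fun n => le_iSup₂_of_le (n : ℂ) (by exact_mod_cast (by omega : (n : ℤ) ≠ m)) le_rfl
  exact (𝒱.iSupIndep_wt m).eq_bot_of_le ((hle_frac.trans h).trans hle_ne)

end CGradedVertexAlgebra

theorem theorem5p4_general {V : Type*} [AddCommGroup V] [Module ℂ V]
    (𝒱 : CGradedVertexAlgebra V) {S : Set V} (hS : 𝒱.StronglyGenerates S)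
    (hnonint : ∀ u ∈ S, ∃ lam, u ∈ 𝒱.wt lam ∧ ∀ n : ℤ, lam ≠ n) (hΩ : 𝒱.Omega ≠ ⊥)
    {N₀ : ℤ} (hbdd : ∀ m < N₀, 𝒱.wt m = ⊥) :
    ∃ h : 𝒱.ZhuLaws,
      Module.rank ℂ (𝒱.ZhuAlgebra h) = 1 ∧ Nonempty (𝒱.ZhuAlgebra h ≃ₐ[ℂ] ℂ) := by
  have htop := CGradedVertexAlgebra.zhuO_sup_span_vac hS hnonint hbdd
  obtain ⟨χ, hχ⟩ := CGradedVertexAlgebra.exists_isFaithfulZhuCharacter htop hΩ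
  let e := hχ.algEquiv hχ.zhuLaws
  exact ⟨hχ.zhuLaws, by simpa using e.toLinearEquiv.lift_rank_eq, ⟨e⟩⟩

theorem theorem5p4 {V : Type*} [AddCommGroup V] [Module ℂ V] [Nontrivial V]
    (𝒱 : CGradedVertexAlgebra V) (k : ℕ) (u : Fin k → V) (wtu : Fin k → ℂ)
    (hgen : 𝒱.IsFinitelyOmegaGeneratedRePos (Set.range u))
    (hu : ∀ j, u j ∈ 𝒱.wt (wtu j))
    (hnonint : ∀ j, ∀ n : ℤ, wtu j ≠ n)
    (hV0 : 𝒱.fracPart 0 = ⨆ n : ℕ, 𝒱.wt n) :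
    ∃ h : 𝒱.ZhuLaws,
      Module.rank ℂ (𝒱.ZhuAlgebra h) = 1 ∧ Nonempty (𝒱.ZhuAlgebra h ≃ₐ[ℂ] ℂ) :=
  theorem5p4_general 𝒱 hgen.strongly_generates
    (Set.forall_mem_range.2 fun j => ⟨wtu j, hu j, hnonint j⟩)
    hgen.omega_generated.omega_ne_bot
    fun _ => CGradedVertexAlgebra.wt_eq_bot_of_neg hV0.le
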